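/- Let $(M,g)$ be a smooth Riemannian manifold without boundary (finite-dimensional and Hausdorff), with Levi-Civita connection $\nabla$, and let $\mathcal{D}\subseteq TM$ be a regular distribution, i.e. a smooth subbundle of $TM$ of constant rank $n$. Let $\Gamma(\mathcal{D})$ be the set of smooth vector fields $X$ on $M$ with $X(p)\in\mathcal{D}_p$ for every $p\in M$. A geodesic is a smooth curve $\gamma:J\to M$ on an open interval $J\subseteq\mathbb{R}$ with $\nabla_{\dot\gamma}\dot\gamma=0$. The distribution $\mathcal{D}$ is called totally geodesic if for every geodesic $\gamma:J\to M$ such that $\dot\gamma(t_0)\in\mathcal{D}_{\gamma(t_0)}$ for some $t_0\in J$, one has $\dot\gamma(t)\in\mathcal{D}_{\gamma(t)}$ for all $t\in J$. Then $\mathcal{D}$ is totally geodesic if and only if $\Gamma(\mathcal{D})$ is closed under the symmetric product, i.e. $\nabla_XY+\nabla_YX\in\Gamma(\mathcal{D})$ for all $X,Y\in\Gamma(\mathcal{D})$. -/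

import Mathlib

open Bundle VectorField
open scoped Manifold ContDiff Topology

noncomputable section

namespace RegDist

set_option linter.unusedSectionVars false

section LeviCivita

variable {E : Type*} [NormedAddCommGroup E] [NormedSpace ℝ E] [FiniteDimensional ℝ E]
  {M : Type*} [TopologicalSpace M] [ChartedSpace E M] [IsManifold 𝓘(ℝ, E) ∞ M]
  [RiemannianBundle (fun x : M ↦ TangentSpace 𝓘(ℝ, E) x)]
  [IsContMDiffRiemannianBundle 𝓘(ℝ, E) ∞ E (fun x : M ↦ TangentSpace 𝓘(ℝ, E) x)]

/-- Vector fields on `M`, without any regularity. -/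
abbrev Field (E M : Type*) [NormedAddCommGroup E] [NormedSpace ℝ E] [TopologicalSpace M]
    [ChartedSpace E M] : Type _ :=
  ∀ x : M, TangentSpace 𝓘(ℝ, E) x

/-- The function `x ↦ g(X x, Y x)`. -/
def metricFun (X Y : Field E M) (x : M) : ℝ := inner ℝ (X x) (Y x)

/-- The right hand side of the Koszul formula for `g(∇_X Y, Z)` at `x`, that is
`½ (X g(Y,Z) + Y g(X,Z) - Z g(X,Y) + g([X,Y],Z) - g([X,Z],Y) - g([Y,Z],X))`. -/
def koszul (x : M) (X Y Z : Field E M) : ℝ :=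
  (1 / 2 : ℝ) * (d% (metricFun Y Z) x (X x) + d% (metricFun X Z) x (Y x)
    - d% (metricFun X Y) x (Z x)
    + inner ℝ (mlieBracket 𝓘(ℝ, E) X Y x) (Z x)
    - inner ℝ (mlieBracket 𝓘(ℝ, E) X Z x) (Y x)
    - inner ℝ (mlieBracket 𝓘(ℝ, E) Y Z x) (X x))

lemma metricFun_comm (X Y : Field E M) : metricFun X Y = metricFun Y X := by
  ext x; exact real_inner_comm _ _

lemma mdiff_metricFun {X Y : Field E M} {x : M} (hX : MDiffAt (T% X) x) (hY : MDiffAt (T% Y) x) :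
    MDiffAt (metricFun X Y) x :=
  MDifferentiableAt.inner_bundle (E := fun x : M ↦ TangentSpace 𝓘(ℝ, E) x) (b := id) hX hY

lemma d_metricFun_add_left {X X' Y : Field E M} {x : M} (hX : MDiffAt (T% X) x)
    (hX' : MDiffAt (T% X') x) (hY : MDiffAt (T% Y) x) (v : TangentSpace 𝓘(ℝ, E) x) :
    d% (metricFun (X + X') Y) x v = d% (metricFun X Y) x v + d% (metricFun X' Y) x v := by
  have : metricFun (X + X') Y = metricFun X Y + metricFun X' Y := by
    ext y; exact inner_add_left _ _ _
  rw [this, mvfderiv_add (mdiff_metricFun hX hY) (mdiff_metricFun hX' hY)]; rfl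

lemma d_metricFun_smul_left {X Y : Field E M} {f : M → ℝ} {x : M} (hf : MDiffAt f x)
    (hX : MDiffAt (T% X) x) (hY : MDiffAt (T% Y) x) (v : TangentSpace 𝓘(ℝ, E) x) :
    d% (metricFun (f • X) Y) x v
      = f x * d% (metricFun X Y) x v + d% f x v * inner ℝ (X x) (Y x) := by
  have : metricFun (f • X) Y = f * metricFun X Y := by
    ext y; exact real_inner_smul_left _ _ _
  rw [this, mvfderiv_mul hf (mdiff_metricFun hX hY)]
  simp [metricFun, mul_comm]

lemma d_metricFun_add_right {X Y Y' : Field E M} {x : M} (hX : MDiffAt (T% X) x)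
    (hY : MDiffAt (T% Y) x) (hY' : MDiffAt (T% Y') x) (v : TangentSpace 𝓘(ℝ, E) x) :
    d% (metricFun X (Y + Y')) x v = d% (metricFun X Y) x v + d% (metricFun X Y') x v := by
  rw [metricFun_comm, d_metricFun_add_left hY hY' hX, metricFun_comm Y, metricFun_comm Y']

lemma d_metricFun_smul_right {X Y : Field E M} {f : M → ℝ} {x : M} (hf : MDiffAt f x)
    (hX : MDiffAt (T% X) x) (hY : MDiffAt (T% Y) x) (v : TangentSpace 𝓘(ℝ, E) x) :
    d% (metricFun X (f • Y)) x v
      = f x * d% (metricFun X Y) x v + d% f x v * inner ℝ (X x) (Y x) := by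
  rw [metricFun_comm, d_metricFun_smul_left hf hY hX, metricFun_comm Y, real_inner_comm]

lemma koszul_tensorial_left {x : M} {Y Z : Field E M} (hY : MDiffAt (T% Y) x)
    (hZ : MDiffAt (T% Z) x) :
    TensorialAt 𝓘(ℝ, E) E (fun X : Field E M ↦ koszul x X Y Z) x where
  smul {f X} hf hX := by
    simp only [koszul, d_metricFun_smul_left hf hX hZ, d_metricFun_smul_left hf hX hY,
      mlieBracket_smul_left hf hX, Pi.smul_apply', map_smul, inner_add_left, inner_smul_right,
      real_inner_smul_left, smul_eq_mul]
    ring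
  add {X X'} hX hX' := by
    simp only [koszul, d_metricFun_add_left hX hX' hZ, d_metricFun_add_left hX hX' hY,
      mlieBracket_add_left hX hX', Pi.add_apply, map_add, inner_add_left, inner_add_right]
    ring

lemma koszul_tensorial_right {x : M} {X Y : Field E M} (hX : MDiffAt (T% X) x)
    (hY : MDiffAt (T% Y) x) :
    TensorialAt 𝓘(ℝ, E) E (fun Z : Field E M ↦ koszul x X Y Z) x where
  smul {f Z} hf hZ := by
    simp only [koszul, d_metricFun_smul_right hf hX hZ, d_metricFun_smul_right hf hY hZ,
      mlieBracket_smul_right hf hZ, Pi.smul_apply', map_smul, inner_add_left, inner_smul_right,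
      real_inner_smul_left, smul_eq_mul, real_inner_comm (X x) (Z x), real_inner_comm (Y x) (Z x)]
    ring
  add {Z Z'} hZ hZ' := by
    simp only [koszul, d_metricFun_add_right hX hZ hZ', d_metricFun_add_right hY hZ hZ',
      mlieBracket_add_right hZ hZ', Pi.add_apply, map_add, inner_add_left, inner_add_right]
    ring

lemma koszul_add_mid {x : M} {X Y Y' Z : Field E M} (hX : MDiffAt (T% X) x)
    (hY : MDiffAt (T% Y) x) (hY' : MDiffAt (T% Y') x) (hZ : MDiffAt (T% Z) x) :
    koszul x X (Y + Y') Z = koszul x X Y Z + koszul x X Y' Z := by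
  simp only [koszul, d_metricFun_add_right hX hY hY', d_metricFun_add_left hY hY' hZ,
    mlieBracket_add_right hY hY', mlieBracket_add_left hY hY', Pi.add_apply, map_add,
    inner_add_left, inner_add_right]
  ring

lemma koszul_smul_mid {x : M} {X Y Z : Field E M} {f : M → ℝ} (hf : MDiffAt f x)
    (hX : MDiffAt (T% X) x) (hY : MDiffAt (T% Y) x) (hZ : MDiffAt (T% Z) x) :
    koszul x X (f • Y) Z = f x * koszul x X Y Z + d% f x (X x) * inner ℝ (Y x) (Z x) := by
  simp only [koszul, d_metricFun_smul_right hf hX hY, d_metricFun_smul_left hf hY hZ,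
    mlieBracket_smul_right hf hY, mlieBracket_smul_left hf hY, Pi.smul_apply', map_smul,
    inner_add_left, inner_smul_right, real_inner_smul_left, smul_eq_mul,
    real_inner_comm (X x) (Y x)]
  ring

/-- Metric compatibility at the level of the Koszul expression. -/
lemma koszul_metric (x : M) (X Y Z : Field E M) :
    koszul x X Y Z + koszul x X Z Y = d% (metricFun Y Z) x (X x) := by
  simp only [koszul, metricFun_comm Z Y, mlieBracket_swap_apply (V := Z) (W := Y),
    inner_neg_left]
  ring

/-- Vanishing torsion at the level of the Koszul expression. -/
lemma koszul_torsion (x : M) (X Y Z : Field E M) :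
    koszul x X Y Z - koszul x Y X Z = inner ℝ (mlieBracket 𝓘(ℝ, E) X Y x) (Z x) := by
  simp only [koszul, metricFun_comm Y X, mlieBracket_swap_apply (V := Y) (W := X),
    inner_neg_left]
  ring

/-- The Koszul expression at `x` as a bilinear form in the values `X x` and `Z x`. -/
def koszulForm (Y : Field E M) (x : M) (hY : MDiffAt (T% Y) x) :
    TangentSpace 𝓘(ℝ, E) x →L[ℝ] TangentSpace 𝓘(ℝ, E) x →L[ℝ] ℝ :=
  TensorialAt.mkHom₂ (fun X Z : Field E M ↦ koszul x X Y Z) x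
    (fun _ hZ ↦ koszul_tensorial_left hY hZ) (fun _ hX ↦ koszul_tensorial_right hX hY)

lemma completeSpace_tangentSpace (x : M) : CompleteSpace (TangentSpace 𝓘(ℝ, E) x) :=
  haveI : FiniteDimensional ℝ (TangentSpace 𝓘(ℝ, E) x) := inferInstanceAs (FiniteDimensional ℝ E)
  FiniteDimensional.complete ℝ _

open Classical in
/-- The Levi-Civita covariant derivative as a bare function: `(leviCivitaFun Y x) v = ∇_v Y` is the
vector representing the Koszul form, if `Y` is differentiable at `x` (junk value `0` otherwise). -/
def leviCivitaFun (Y : Field E M) (x : M) :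
    TangentSpace 𝓘(ℝ, E) x →L[ℝ] TangentSpace 𝓘(ℝ, E) x :=
  haveI : FiniteDimensional ℝ (TangentSpace 𝓘(ℝ, E) x) := inferInstanceAs (FiniteDimensional ℝ E)
  haveI : CompleteSpace (TangentSpace 𝓘(ℝ, E) x) := completeSpace_tangentSpace x
  if hY : MDiffAt (T% Y) x then
    LinearMap.toContinuousLinearMap
      { toFun := fun v ↦ (InnerProductSpace.toDual ℝ _).symm (koszulForm Y x hY v)
        map_add' := fun v w ↦ by simp
        map_smul' := fun c v ↦ by simp }
  else 0

/-- The Koszul formula. -/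
lemma inner_leviCivitaFun {X Y Z : Field E M} {x : M} (hX : MDiffAt (T% X) x)
    (hY : MDiffAt (T% Y) x) (hZ : MDiffAt (T% Z) x) :
    inner ℝ (leviCivitaFun Y x (X x)) (Z x) = koszul x X Y Z := by
  have : CompleteSpace (TangentSpace 𝓘(ℝ, E) x) := completeSpace_tangentSpace x
  have h : leviCivitaFun Y x (X x)
      = (InnerProductSpace.toDual ℝ _).symm (koszulForm Y x hY (X x)) := by
    simp [leviCivitaFun, hY]
  rw [h, InnerProductSpace.toDual_symm_apply]
  exact TensorialAt.mkHom₂_apply _ _ hX hZ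

lemma ext_inner_field {x : M} {u w : TangentSpace 𝓘(ℝ, E) x}
    (h : ∀ Z : Field E M, MDiffAt (T% Z) x → inner ℝ u (Z x) = inner ℝ w (Z x)) : u = w := by
  refine ext_inner_right ℝ fun v ↦ ?_
  simpa using h (FiberBundle.extend E v) (FiberBundle.mdifferentiableAt_extend ..)

variable (E M) in
/-- The Levi-Civita connection of the Riemannian manifold `M`: `leviCivita E M Y x v = (∇_v Y)(x)`. -/
def leviCivita : CovariantDerivative 𝓘(ℝ, E) E (fun x : M ↦ TangentSpace 𝓘(ℝ, E) x) where
  toFun := leviCivitaFun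
  isCovariantDerivativeOnUniv :=
    { add := fun {Y Y'} x hY hY' _ ↦ by
        ext1 v
        refine ext_inner_field fun Z hZ ↦ ?_
        have hV : MDiffAt (T% (FiberBundle.extend E v)) x := FiberBundle.mdifferentiableAt_extend ..
        have hv : v = FiberBundle.extend E v x := by simp
        rw [hv, add_apply, inner_add_left,
          inner_leviCivitaFun hV (mdifferentiableAt_add_section hY hY') hZ,
          inner_leviCivitaFun hV hY hZ, inner_leviCivitaFun hV hY' hZ, koszul_add_mid hV hY hY' hZ]
      leibniz := fun {Y f} x hY hf _ ↦ by
        ext1 v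
        refine ext_inner_field fun Z hZ ↦ ?_
        have hV : MDiffAt (T% (FiberBundle.extend E v)) x := FiberBundle.mdifferentiableAt_extend ..
        have hv : v = FiberBundle.extend E v x := by simp
        rw [hv, add_apply, smul_apply,
          ContinuousLinearMap.smulRight_apply, inner_add_left, real_inner_smul_left,
          real_inner_smul_left,
          inner_leviCivitaFun hV (hf.smul_section hY) hZ,
          inner_leviCivitaFun hV hY hZ, koszul_smul_mid hf hV hY hZ] }

/-- The Levi-Civita connection is compatible with the metric:
`X g(Y, Z) = g(∇_X Y, Z) + g(Y, ∇_X Z)`. -/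
theorem leviCivita_metric {X Y Z : Field E M} {x : M} (hX : MDiffAt (T% X) x)
    (hY : MDiffAt (T% Y) x) (hZ : MDiffAt (T% Z) x) :
    d% (metricFun Y Z) x (X x)
      = inner ℝ (leviCivita E M Y x (X x)) (Z x) + inner ℝ (Y x) (leviCivita E M Z x (X x)) := by
  rw [← koszul_metric x X Y Z, ← inner_leviCivitaFun hX hY hZ, ← inner_leviCivitaFun hX hZ hY,
    real_inner_comm (Y x) (leviCivitaFun Z x (X x))]
  rfl

/-- The Levi-Civita connection is torsion-free: `∇_X Y - ∇_Y X = [X, Y]`. -/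
theorem leviCivita_torsion {X Y : Field E M} {x : M} (hX : MDiffAt (T% X) x)
    (hY : MDiffAt (T% Y) x) :
    leviCivita E M Y x (X x) - leviCivita E M X x (Y x) = mlieBracket 𝓘(ℝ, E) X Y x := by
  refine ext_inner_field fun Z hZ ↦ ?_
  rw [inner_sub_left, ← koszul_torsion x X Y Z, ← inner_leviCivitaFun hX hY hZ,
    ← inner_leviCivitaFun hY hX hZ]
  rfl

end LeviCivita

section Curves

variable {E : Type*} [NormedAddCommGroup E] [NormedSpace ℝ E]
  {M : Type*} [TopologicalSpace M] [ChartedSpace E M]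

/-- The velocity `γ'(t)`, a tangent vector at `γ t`. -/
def velocity (γ : ℝ → M) (t : ℝ) : TangentSpace 𝓘(ℝ, E) (γ t) :=
  mfderiv 𝓘(ℝ, ℝ) 𝓘(ℝ, E) γ t (1 : ℝ)

/-- The covariant derivative at time `t` of a vector field `V` along a curve `γ`, with respect to a
connection `cov` on the tangent bundle. Write `v j` for the components of `V` in the coordinate
frame `∂ j` of the preferred chart at `γ t`; then
`DV/dt = ∑ j, (v j)'(t) • ∂ j + ∑ j, v j (t) • ∇_{γ'(t)} ∂ j`.
Below, `e.symm y w` is the tangent vector at `y` with components `w` in that chart. -/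
def covariantDerivAlong [IsManifold 𝓘(ℝ, E) 1 M]
    (cov : CovariantDerivative 𝓘(ℝ, E) E (fun x : M ↦ TangentSpace 𝓘(ℝ, E) x))
    (γ : ℝ → M) (V : ∀ t : ℝ, TangentSpace 𝓘(ℝ, E) (γ t)) (t : ℝ) :
    TangentSpace 𝓘(ℝ, E) (γ t) :=
  let e := trivializationAt E (fun x : M ↦ TangentSpace 𝓘(ℝ, E) x) (γ t)
  let v : ℝ → E := fun s ↦ (e ⟨γ s, V s⟩).2
  e.symm (γ t) (deriv v t) + cov (fun y : M ↦ e.symm y (v t)) (γ t) (velocity γ t)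

end Curves

section Distribution

variable (E : Type*) [NormedAddCommGroup E] [NormedSpace ℝ E]
  (M : Type*) [TopologicalSpace M] [ChartedSpace E M]

/-- A regular distribution of rank `n`: a smooth rank `n` subbundle of the tangent bundle, i.e. a
family of subspaces of the tangent spaces that is spanned, near every point, by `n` pointwise
linearly independent smooth vector fields. -/
structure RegularDistribution [IsManifold 𝓘(ℝ, E) ∞ M] (n : ℕ) where
  /-- The fibre `D_p`. -/
  fiber : ∀ p : M, Submodule ℝ (TangentSpace 𝓘(ℝ, E) p)
  exists_localFrame : ∀ p : M, ∃ U ∈ 𝓝 p, ∃ X : Fin n → Field E M,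
    (∀ i, CMDiff[U] ∞ (T% (X i))) ∧
    ∀ q ∈ U, LinearIndependent ℝ (fun i ↦ X i q) ∧
      Submodule.span ℝ (Set.range fun i ↦ X i q) = fiber q

variable {E M}

/-- `Γ(D)`: the smooth vector fields on `M` with values in `D`. -/
def RegularDistribution.sections [IsManifold 𝓘(ℝ, E) ∞ M] {n : ℕ}
    (D : RegularDistribution E M n) : Set (Field E M) :=
  {X | CMDiff ∞ (T% X) ∧ ∀ p, X p ∈ D.fiber p}

variable [FiniteDimensional ℝ E] [IsManifold 𝓘(ℝ, E) ∞ M]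
  [RiemannianBundle (fun x : M ↦ TangentSpace 𝓘(ℝ, E) x)]
  [IsContMDiffRiemannianBundle 𝓘(ℝ, E) ∞ E (fun x : M ↦ TangentSpace 𝓘(ℝ, E) x)]

/-- `∇_X Y`, for the Levi-Civita connection `∇`. -/
def nabla (X Y : Field E M) : Field E M := fun p ↦ leviCivita E M Y p (X p)

variable (E) in
/-- `γ` restricts to a smooth curve on the open set `J` with `∇_γ' γ' = 0`. -/
def IsGeodesicOn (γ : ℝ → M) (J : Set ℝ) : Prop :=
  CMDiff[J] ∞ γ ∧ ∀ t ∈ J, covariantDerivAlong (leviCivita E M) γ (velocity γ) t = 0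

/-- `D` is totally geodesic: a geodesic, defined on any open interval, whose velocity lies in `D` at
some time has its velocity in `D` at all times. -/
def RegularDistribution.IsTotallyGeodesic {n : ℕ} (D : RegularDistribution E M n) : Prop :=
  ∀ (J : Set ℝ) (γ : ℝ → M), IsOpen J → J.OrdConnected → IsGeodesicOn E γ J →
    ∀ t₀ ∈ J, velocity γ t₀ ∈ D.fiber (γ t₀) → ∀ t ∈ J, velocity γ t ∈ D.fiber (γ t)

end Distribution
end RegDist
end

/-! Near a point, complete a frame of `D` to a frame of the tangent bundle (indices `Sum.inl` for
`D`, `Sum.inr` for the transverse fields). A vector lies in `D` iff its transverse components vanish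
(`mem_span_inl_iff_coeff_inr`). If `a` denotes the components of the velocity of a geodesic, then
`a_k' = -∑ a_i a_j C^k_ij`, where `C^k_ij` is the `k`-th component of `∇_{X_j} X_i`
(`IsGeodesicOn.hasDerivAt_coeff`).

If `Γ(D)` is closed under the symmetric product, then for transverse `k` the `C^k_ij` are
antisymmetric in indices `i`, `j` of `D`. These terms cancel in the sum, and each remaining one
contains a transverse component. Along a fixed geodesic the transverse components thus solve a
homogeneous linear equation with continuous coefficients, so their vanishing is open and closed in
time (`eventually_velocity_mem_iff`).

Conversely, take `X` in `Γ(D)` and the geodesic through `p` with velocity `X p`. The transverse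
components of `∇_X X` at `p` and of the acceleration each consist of a derivative term and the same
quadratic term. Both derivative terms vanish, as `X` and the velocity stay in `D`; the acceleration
is zero, hence so is the quadratic term, and `∇_X X` lies in `D`. Polarization yields the symmetric
product. -/

set_option linter.unusedSectionVars false

/-! ### Smooth dependence of solutions of linear systems. -/

section LinearSystem

variable {𝕜 : Type*} [NontriviallyNormedField 𝕜]
  {E : Type*} [NormedAddCommGroup E] [NormedSpace 𝕜 E] {H : Type*} [TopologicalSpace H]
  {I : ModelWithCorners 𝕜 E H} {M : Type*} [TopologicalSpace M] [ChartedSpace H M]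
  {ι : Type*} [Fintype ι] [DecidableEq ι] {n : ℕ∞ω} {u : Set M}

lemma ContMDiffOn.matrix_det {A : M → Matrix ι ι 𝕜} (hA : ∀ i j, CMDiff[u] n (fun x ↦ A x i j)) :
    CMDiff[u] n (fun x ↦ (A x).det) := by
  simp only [Matrix.det_apply, Units.smul_def, zsmul_eq_mul]
  exact contMDiffOn_finsetSum fun σ _ ↦ contMDiffOn_const.mul
    (contMDiffOn_finsetProd fun i _ ↦ hA _ _)

/-- The solution of an invertible linear system depends on it as smoothly as the coefficients. -/
lemma contMDiffOn_of_linear_system {A : M → Matrix ι ι 𝕜} {w h : M → ι → 𝕜}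
    (hA : ∀ i j, CMDiff[u] n (fun x ↦ A x i j)) (hh : ∀ i, CMDiff[u] n (fun x ↦ h x i))
    (hdet : ∀ x ∈ u, (A x).det ≠ 0) (hw : ∀ x ∈ u, ∀ i, ∑ j, A x i j * w x j = h x i) (i : ι) :
    CMDiff[u] n (fun x ↦ w x i) := by
  have hnum : CMDiff[u] n (fun x ↦ ((A x).updateCol i (h x)).det) :=
    ContMDiffOn.matrix_det fun k l ↦ by
      rcases eq_or_ne l i with rfl | hl
      · simpa using hh k
      · simpa [Matrix.updateCol_ne hl] using hA k l
  -- Cramer's rule writes each unknown as a quotient of determinants.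
  refine (hnum.div₀ (ContMDiffOn.matrix_det hA) hdet).congr fun x hx ↦ ?_
  have hAw : (A x).mulVec (w x) = h x := funext (hw x hx)
  rw [Pi.div_apply, eq_div_iff (hdet x hx), ← Matrix.cramer_apply, ← hAw, Matrix.cramer_eq_adjugate_mulVec,
    Matrix.mulVec_mulVec, Matrix.adjugate_mul, Matrix.smul_mulVec, Matrix.one_mulVec]
  simp [mul_comm]

end LinearSystem

/-! ### Coefficients of sections in a smooth local frame. -/

section FrameCoeff

variable {𝕜 : Type*} [NontriviallyNormedField 𝕜] [CompleteSpace 𝕜]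
  {E : Type*} [NormedAddCommGroup E] [NormedSpace 𝕜 E] {H : Type*} [TopologicalSpace H]
  {I : ModelWithCorners 𝕜 E H} {M : Type*} [TopologicalSpace M] [ChartedSpace H M]
  {F : Type*} [NormedAddCommGroup F] [NormedSpace 𝕜 F] [FiniteDimensional 𝕜 F]
  {V : M → Type*} [TopologicalSpace (TotalSpace F V)]
  [∀ x, AddCommGroup (V x)] [∀ x, Module 𝕜 (V x)] [∀ x : M, TopologicalSpace (V x)]
  [FiberBundle F V] [VectorBundle 𝕜 F V]
  {ι : Type*} [Fintype ι] {n : ℕ∞ω} {u : Set M} {s : ι → (x : M) → V x} {t : (x : M) → V x}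

lemma IsLocalFrameOn.coeff_mono {u' : Set M} (hs : IsLocalFrameOn I F n s u) (h : u' ⊆ u) {x : M}
    (hx : x ∈ u') (i : ι) : (hs.mono h).coeff i x = hs.coeff i x := by
  simp only [IsLocalFrameOn.coeff, dif_pos hx, dif_pos (h hx)]
  rfl

/-- The coefficients of a smooth section in a smooth local frame are smooth. -/
lemma IsLocalFrameOn.contMDiffOn_coeff [ContMDiffVectorBundle n F V I]
    [ContMDiffVectorBundle 1 F V I]
    (hs : IsLocalFrameOn I F n s u) (hu : IsOpen u)
    (ht : CMDiff[u] n (T% t)) (i : ι) : CMDiff[u] n (fun x ↦ hs.coeff i x (t x)) := by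
  classical
  intro p hp
  let e := trivializationAt F V p
  have hpe : p ∈ e.baseSet := FiberBundle.mem_baseSet_trivializationAt' p
  let b := (hs.toBasisAt hp).map (e.linearEquivAt 𝕜 p hpe)
  have hopen : IsOpen (u ∩ e.baseSet) := hu.inter e.open_baseSet
  refine ContMDiffAt.contMDiffWithinAt (ContMDiffOn.contMDiffAt (s := u ∩ e.baseSet) ?_
    (hopen.mem_nhds ⟨hp, hpe⟩))
  -- Pairing `t = ∑ coeff j • s j` with the coordinates of a trivialization gives a linear system
  -- for the coefficients; its matrix is a change of basis.
  refine contMDiffOn_of_linear_system (ι := ι)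
    (A := fun x ↦ Matrix.of fun k j ↦ e.localFrameCoeff I b k x (s j x))
    (w := fun x j ↦ hs.coeff j x (t x))
    (h := fun x k ↦ e.localFrameCoeff I b k x (t x)) (fun k j ↦ ?_) (fun k ↦ ?_)
    (fun x hx ↦ ?_) (fun x hx k ↦ ?_) i
  · exact contMDiffOn_localFrameCoeff b hopen Set.inter_subset_right
      ((hs.contMDiffOn j).mono Set.inter_subset_left) k
  · exact contMDiffOn_localFrameCoeff b hopen Set.inter_subset_right
      (ht.mono Set.inter_subset_left) k
  · have : (Matrix.of fun k j ↦ e.localFrameCoeff I b k x (s j x))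
        = (e.basisAt b hx.2).toMatrix (hs.toBasisAt hx.1) := by
      ext k j
      simp [Module.Basis.toMatrix_apply, e.localFrameCoeff_apply_of_mem_baseSet b hx.2 (s j) k]
    rw [this]
    exact Matrix.det_ne_zero_of_left_inverse
      (Module.Basis.toMatrix_mul_toMatrix_flip (hs.toBasisAt hx.1) (e.basisAt b hx.2))
  · conv_rhs => rw [hs.coeff_sum_eq t hx.1]
    simp [map_sum, mul_comm]

end FrameCoeff

/-! ### Smoothness of the Levi-Civita connection. -/

section Smoothness

/-- The function is the fibre component of the tangent map of `f` composed with the section `X`. -/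
lemma contMDiffOn_mvfderiv_apply {E : Type*} [NormedAddCommGroup E] [NormedSpace ℝ E]
    {M : Type*} [TopologicalSpace M] [ChartedSpace E M] [IsManifold 𝓘(ℝ, E) ∞ M]
    {u : Set M} (hu : IsOpen u) {f : M → ℝ} (hf : CMDiff[u] ∞ f)
    {X : ∀ x : M, TangentSpace 𝓘(ℝ, E) x} (hX : CMDiff[u] ∞ (T% X)) :
    CMDiff[u] ∞ (fun x ↦ d% f x (X x)) := by
  have h1 := hf.contMDiffOn_tangentMapWithin (m := ∞) (by simp) hu.uniqueMDiffOn
  have h2 := h1.comp hX (fun x hx ↦ hx)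
  have h3 := (contMDiff_snd_tangentBundle_modelSpace ℝ 𝓘(ℝ, ℝ) (n := ∞)).comp_contMDiffOn h2
  refine h3.congr fun x hx ↦ ?_
  change _ = mfderivWithin 𝓘(ℝ, E) 𝓘(ℝ, ℝ) f u x (X x)
  rw [mfderivWithin_of_isOpen hu hx]
  rfl

lemma mdifferentiableAt_section_of_contMDiffOn {E : Type*} [NormedAddCommGroup E]
    [NormedSpace ℝ E] {M : Type*} [TopologicalSpace M] [ChartedSpace E M]
    [IsManifold 𝓘(ℝ, E) ∞ M] {u : Set M} (hu : IsOpen u)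
    {X : ∀ x : M, TangentSpace 𝓘(ℝ, E) x} (hX : CMDiff[u] ∞ (T% X)) {x : M} (hx : x ∈ u) :
    MDiffAt (T% X) x :=
  (hX.contMDiffAt (hu.mem_nhds hx)).mdifferentiableAt (by simp)

namespace RegDist

variable {E : Type*} [NormedAddCommGroup E] [NormedSpace ℝ E] [FiniteDimensional ℝ E]
  {M : Type*} [TopologicalSpace M] [ChartedSpace E M] [IsManifold 𝓘(ℝ, E) ∞ M]
  [RiemannianBundle (fun x : M ↦ TangentSpace 𝓘(ℝ, E) x)]
  [IsContMDiffRiemannianBundle 𝓘(ℝ, E) ∞ E (fun x : M ↦ TangentSpace 𝓘(ℝ, E) x)]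
  {u : Set M} {X Y Z : Field E M}

lemma contMDiffOn_metricFun (hX : CMDiff[u] ∞ (T% X)) (hY : CMDiff[u] ∞ (T% Y)) :
    CMDiff[u] ∞ (metricFun X Y) :=
  ContMDiffOn.inner_bundle (E := fun x : M ↦ TangentSpace 𝓘(ℝ, E) x) (b := id) hX hY

lemma contMDiffOn_mlieBracket (hu : IsOpen u) (hX : CMDiff[u] ∞ (T% X))
    (hY : CMDiff[u] ∞ (T% Y)) : CMDiff[u] ∞ (T% (mlieBracket 𝓘(ℝ, E) X Y)) := by
  have : IsManifold 𝓘(ℝ, E) (((⊤ : ℕ∞) : ℕ∞ω) + 1) M := by simpa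
  have : IsManifold 𝓘(ℝ, E) (minSmoothness ℝ 2) M := by
    simpa using (inferInstance : IsManifold 𝓘(ℝ, E) 2 M)
  refine (hX.mlieBracketWithin_vectorField (m := ⊤) (n := ⊤) hY hu.uniqueMDiffOn (by simp)).congr
    fun x hx ↦ ?_
  rw [mlieBracketWithin_of_isOpen hu hx]

lemma contMDiffOn_koszul (hu : IsOpen u) (hX : CMDiff[u] ∞ (T% X))
    (hY : CMDiff[u] ∞ (T% Y)) (hZ : CMDiff[u] ∞ (T% Z)) :
    CMDiff[u] ∞ (fun x ↦ koszul x X Y Z) := by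
  have h1 := contMDiffOn_mvfderiv_apply hu (contMDiffOn_metricFun hY hZ) hX
  have h2 := contMDiffOn_mvfderiv_apply hu (contMDiffOn_metricFun hX hZ) hY
  have h3 := contMDiffOn_mvfderiv_apply hu (contMDiffOn_metricFun hX hY) hZ
  have h4 := contMDiffOn_metricFun (contMDiffOn_mlieBracket hu hX hY) hZ
  have h5 := contMDiffOn_metricFun (contMDiffOn_mlieBracket hu hX hZ) hY
  have h6 := contMDiffOn_metricFun (contMDiffOn_mlieBracket hu hY hZ) hX
  exact (contMDiffOn_const (c := (1 / 2 : ℝ))).mul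
    (((((h1.add h2).sub h3).add h4).sub h5).sub h6)

/-- The Levi-Civita connection of a smooth metric is smooth. -/
lemma contMDiffOn_nabla (hu : IsOpen u) (hX : CMDiff[u] ∞ (T% X)) (hY : CMDiff[u] ∞ (T% Y)) :
    CMDiff[u] ∞ (T% (nabla X Y)) := by
  classical
  intro p hp
  let e := trivializationAt E (fun x : M ↦ TangentSpace 𝓘(ℝ, E) x) p
  have hpe : p ∈ e.baseSet := FiberBundle.mem_baseSet_trivializationAt' p
  let b := Module.finBasis ℝ E
  have hopen : IsOpen (u ∩ e.baseSet) := hu.inter e.open_baseSet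
  have hs := (e.isLocalFrameOn_localFrame_baseSet 𝓘(ℝ, E) ∞ b).mono
    (Set.inter_subset_right (s := u))
  have hX' := hX.mono (Set.inter_subset_left (t := e.baseSet))
  have hY' := hY.mono (Set.inter_subset_left (t := e.baseSet))
  refine ContMDiffAt.contMDiffWithinAt (hs.contMDiffAt_of_coeff (fun i ↦ ?_)
    (hopen.mem_nhds ⟨hp, hpe⟩))
  refine ContMDiffOn.contMDiffAt (s := u ∩ e.baseSet) ?_ (hopen.mem_nhds ⟨hp, hpe⟩)
  -- By the Koszul formula, the components of `∇_X Y` solve a system whose matrix is the Gram matrix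
  -- of the frame and whose right-hand side is smooth.
  refine contMDiffOn_of_linear_system
    (A := fun x ↦ Matrix.gram ℝ (fun k ↦ e.localFrame b k x))
    (w := fun x j ↦ hs.coeff j x (nabla X Y x))
    (h := fun x k ↦ koszul x X Y (e.localFrame b k)) (fun k j ↦ ?_) (fun k ↦ ?_)
    (fun x hx ↦ ?_) (fun x hx k ↦ ?_) i
  · exact contMDiffOn_metricFun (hs.contMDiffOn k) (hs.contMDiffOn j)
  · exact contMDiffOn_koszul hopen hX' hY' (hs.contMDiffOn k)
  · exact (Matrix.det_gram_ne_zero_iff_linearIndependent).2 (hs.linearIndependent hx)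
  · rw [← inner_leviCivitaFun (mdifferentiableAt_section_of_contMDiffOn hopen hX' hx)
      (mdifferentiableAt_section_of_contMDiffOn hopen hY' hx) (mdifferentiableAt_section_of_contMDiffOn hopen (hs.contMDiffOn k) hx)]
    change _ = inner ℝ (nabla X Y x) _
    conv_rhs => rw [hs.coeff_sum_eq (nabla X Y) hx]
    simp only [Matrix.gram_apply, sum_inner, real_inner_smul_left]
    exact Finset.sum_congr rfl fun j _ ↦ by rw [mul_comm, real_inner_comm]

end RegDist

end Smoothness

/-! ### Covariant differentiation along curves in an arbitrary frame. -/

section AlongCurves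

variable {E : Type*} [NormedAddCommGroup E] [NormedSpace ℝ E]
  {M : Type*} [TopologicalSpace M] [ChartedSpace E M]

lemma RegDist.hasDerivAt_comp_curve {f : M → ℝ} {γ : ℝ → M} {t : ℝ} (hf : MDiffAt f (γ t))
    (hγ : MDiffAt γ t) :
    HasDerivAt (fun s ↦ f (γ s)) (d% f (γ t) (RegDist.velocity γ t)) t := by
  have h : MDifferentiableAt 𝓘(ℝ, ℝ) 𝓘(ℝ, ℝ) (f ∘ γ) t := hf.comp t hγ
  have h1 := mvfderiv_comp_apply t hf hγ (1 : ℝ)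
  have h2 : d% (f ∘ γ) t (1 : ℝ) = deriv (f ∘ γ) t := by
    rw [← fderiv_apply_one_eq_deriv, ← mfderiv_eq_fderiv]
    rfl
  rw [h2] at h1
  have h3 := h.differentiableAt.hasDerivAt
  rw [h1] at h3
  exact h3

variable [IsManifold 𝓘(ℝ, E) ∞ M]
  (cov : CovariantDerivative 𝓘(ℝ, E) E (fun x : M ↦ TangentSpace 𝓘(ℝ, E) x))

namespace CovariantDerivative

variable {ι : Type*}

/-- Additivity of `cov` requires differentiable summands, so differentiability is carried through
the same induction as the Leibniz formula. -/
lemma sum_smul {s : Finset ι} {f : ι → M → ℝ} {X : ι → ∀ x : M, TangentSpace 𝓘(ℝ, E) x} {x : M}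
    (hf : ∀ i, MDiffAt (f i) x) (hX : ∀ i, MDiffAt (T% (X i)) x) (v : TangentSpace 𝓘(ℝ, E) x) :
    MDiffAt (T% (fun y ↦ ∑ i ∈ s, f i y • X i y)) x ∧
    cov (fun y ↦ ∑ i ∈ s, f i y • X i y) x v
      = ∑ i ∈ s, (f i x • cov (X i) x v + d% (f i) x v • X i x) := by
  classical
  have hfun (s : Finset ι) : (fun y ↦ ∑ i ∈ s, f i y • X i y) = ∑ i ∈ s, f i • X i := by
    ext y; simp
  simp only [hfun]
  induction s using Finset.induction_on with
  | empty =>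
    simp only [Finset.sum_empty]
    exact ⟨mdifferentiableAt_zeroSection .., by simp⟩
  | insert i s hi ih =>
    simp only [Finset.sum_insert hi]
    have h := (hf i).smul_section (hX i)
    have ih' : MDiffAt (T% (∑ i ∈ s, f i • X i)) x := by
      simp only [Finset.sum_apply, Pi.smul_apply']
      exact ih.1
    refine ⟨mdifferentiableAt_add_section h ih.1, ?_⟩
    rw [cov.isCovariantDerivativeOnUniv.add h ih',
      cov.isCovariantDerivativeOnUniv.leibniz (hX i) (hf i), add_apply, ih.2]
    rfl

lemma congr_of_eventuallyEq {X Y : ∀ x : M, TangentSpace 𝓘(ℝ, E) x} {x : M}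
    (hX : MDiffAt (T% X) x) (hY : MDiffAt (T% Y) x) (h : ∀ᶠ y in 𝓝 x, X y = Y y) :
    cov X x = cov Y x :=
  cov.isCovariantDerivativeOnUniv.congr_of_eventuallyEq hX hY Filter.univ_mem h

variable [Fintype ι] (b : Module.Basis ι ℝ E) {q : M}

lemma symm_const_eq (p : M) {y : M}
    (hy : y ∈ (trivializationAt E (fun x : M ↦ TangentSpace 𝓘(ℝ, E) x) p).baseSet) (v : E) :
    (trivializationAt E (fun x : M ↦ TangentSpace 𝓘(ℝ, E) x) p).symm y v
      = ∑ k, b.repr v k •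
        (trivializationAt E (fun x : M ↦ TangentSpace 𝓘(ℝ, E) x) p).localFrame b k y := by
  set e := trivializationAt E (fun x : M ↦ TangentSpace 𝓘(ℝ, E) x) p
  have h1 (w : E) : e.symm y w = e.symmₗ ℝ y w :=
    (e.symmₗ_apply hy w).symm
  conv_lhs => rw [← b.sum_repr v, h1, map_sum]
  refine Finset.sum_congr rfl fun k _ ↦ ?_
  rw [map_smul, e.localFrame_apply_of_mem_baseSet b hy, ← h1]
  simp [Trivialization.basisAt]

/-- This evaluates the connection term of `covariantDerivAlong`: the components are constant, so the
Leibniz rule leaves no derivative terms. -/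
lemma symm_const_apply (v : E) (w : TangentSpace 𝓘(ℝ, E) q) :
    cov (fun y ↦ (trivializationAt E (fun x : M ↦ TangentSpace 𝓘(ℝ, E) x) q).symm y v) q w
      = ∑ k, b.repr v k • cov
        ((trivializationAt E (fun x : M ↦ TangentSpace 𝓘(ℝ, E) x) q).localFrame b k) q w := by
  set e := trivializationAt E (fun x : M ↦ TangentSpace 𝓘(ℝ, E) x) q
  have hq : q ∈ e.baseSet := FiberBundle.mem_baseSet_trivializationAt' q
  have hfr (k : ι) : MDiffAt (T% (e.localFrame b k)) q :=
    (contMDiffAt_localFrame_of_mem (n := ∞) e b k hq).mdifferentiableAt (by simp)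
  have h := cov.sum_smul (s := Finset.univ) (f := fun k _ ↦ b.repr v k)
    (fun k ↦ mdifferentiableAt_const) hfr w
  have hev : ∀ᶠ y in 𝓝 q, e.symm y v = ∑ k, b.repr v k • e.localFrame b k y :=
    Filter.eventually_of_mem (e.open_baseSet.mem_nhds hq) fun y hy ↦ symm_const_eq b q hy v
  have hd : MDiffAt (T% (fun y ↦ e.symm y v)) q :=
    h.1.congr_of_eventuallyEq (hev.mono fun y hy ↦ by simp [hy])
  rw [cov.congr_of_eventuallyEq hd h.1 hev, h.2]
  simp [mvfderiv_const]
  rfl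

end CovariantDerivative

namespace RegDist

variable [FiniteDimensional ℝ E] {ι : Type*} [Fintype ι]

/-- The covariant derivative along a curve may be computed in any family of vector fields. -/
lemma covariantDerivAlong_eq_sum {γ : ℝ → M} {t : ℝ} (hγ : MDiffAt γ t)
    {X : ι → Field E M} (hX : ∀ i, MDiffAt (T% (X i)) (γ t)) {a : ι → ℝ → ℝ} {a' : ι → ℝ}
    (ha : ∀ i, HasDerivAt (a i) (a' i) t) {V : ∀ s : ℝ, TangentSpace 𝓘(ℝ, E) (γ s)}
    (hV : ∀ᶠ s in 𝓝 t, V s = ∑ i, a i s • X i (γ s)) :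
    covariantDerivAlong cov γ V t
      = ∑ i, (a' i • X i (γ t) + a i t • cov (X i) (γ t) (velocity γ t)) := by
  set e := trivializationAt E (fun x : M ↦ TangentSpace 𝓘(ℝ, E) x) (γ t) with he
  have hq : γ t ∈ e.baseSet := FiberBundle.mem_baseSet_trivializationAt' _
  let b := Module.finBasis ℝ E
  have hfr (k) : MDiffAt (T% (e.localFrame b k)) (γ t) :=
    (contMDiffAt_localFrame_of_mem (n := ∞) e b k hq).mdifferentiableAt (by simp)
  -- Both sides are expanded in the chart frame; the derivatives of the transition functions `c`
  -- occur once through the product rule for the components of `V` and once through the Leibniz rule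
  -- for `cov (X i)`.
  let c (i : ι) (k) (y : M) : ℝ := e.localFrameCoeff 𝓘(ℝ, E) b k y (X i y)
  have hc (i k) : MDiffAt (c i k) (γ t) :=
    mdifferentiableAt_localFrameCoeff b hq (hX i) k
  have hXc (i) : cov (X i) (γ t) (velocity γ t) =
      ∑ k, (c i k (γ t) • cov (e.localFrame b k) (γ t) (velocity γ t)
        + d% (c i k) (γ t) (velocity γ t) • e.localFrame b k (γ t)) := by
    have h := cov.sum_smul (s := Finset.univ) (hc i) hfr (velocity γ t)
    rw [← h.2]
    refine congrFun (congrArg DFunLike.coe ?_) _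
    exact cov.congr_of_eventuallyEq (hX i) h.1
      (e.eventually_eq_localFrame_sum_coeff_smul b hq)
  have hv (s : ℝ) (hs : γ s ∈ e.baseSet) (hVs : V s = ∑ i, a i s • X i (γ s)) :
      (e ⟨γ s, V s⟩).2 = ∑ k, (∑ i, a i s * c i k (γ s)) • b k := by
    rw [← b.sum_repr (e ⟨γ s, V s⟩).2]
    refine Finset.sum_congr rfl fun k _ ↦ ?_
    congr 1
    have hco (W : TangentSpace 𝓘(ℝ, E) (γ s)) :
        b.repr (e ⟨γ s, W⟩).2 k = e.localFrameCoeff 𝓘(ℝ, E) b k (γ s) W := by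
      have := e.localFrameCoeff_eq_coeff (I := 𝓘(ℝ, E)) (b := b) (i := k)
        (s := FiberBundle.extend E W) hs
      simpa using this.symm
    rw [hco, hVs]
    simp [c]
  have hvd : HasDerivAt (fun s ↦ (e ⟨γ s, V s⟩).2)
      (∑ k, (∑ i, (a' i * c i k (γ t) + a i t * d% (c i k) (γ t) (velocity γ t))) • b k) t := by
    have h1 : HasDerivAt (fun s ↦ ∑ k, (∑ i, a i s * c i k (γ s)) • b k)
        (∑ k, (∑ i, (a' i * c i k (γ t) + a i t * d% (c i k) (γ t) (velocity γ t))) • b k) t :=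
      HasDerivAt.fun_sum fun k _ ↦ HasDerivAt.smul_const
        (HasDerivAt.fun_sum fun i _ ↦ (ha i).mul (hasDerivAt_comp_curve (hc i k) hγ)) _
    refine h1.congr_of_eventuallyEq ?_
    filter_upwards [hV, hγ.continuousAt.preimage_mem_nhds (e.open_baseSet.mem_nhds hq)] with s h2 h3
    exact hv s h3 h2
  have hXq (i) : X i (γ t) = ∑ k, c i k (γ t) • e.localFrame b k (γ t) :=
    e.eq_sum_localFrameCoeff_smul hq
  unfold covariantDerivAlong
  simp only [← he]
  rw [hvd.deriv, CovariantDerivative.symm_const_eq b (γ t) hq, cov.symm_const_apply b,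
    hv t hq hV.self_of_nhds]
  change ∑ k, _ • e.localFrame b k (γ t) + ∑ k, _ • cov (e.localFrame b k) (γ t) _ = _
  rw [b.repr_sum_self, b.repr_sum_self, ← Finset.sum_add_distrib]
  calc _ = ∑ k, ∑ i, (a' i • c i k (γ t) • e.localFrame b k (γ t)
        + a i t • (c i k (γ t) • cov (e.localFrame b k) (γ t) (velocity γ t)
        + d% (c i k) (γ t) (velocity γ t) • e.localFrame b k (γ t))) := by
        refine Finset.sum_congr rfl fun k _ ↦ ?_
        rw [Finset.sum_smul, Finset.sum_smul, ← Finset.sum_add_distrib]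
        exact Finset.sum_congr rfl fun i _ ↦ by module
    _ = _ := by
        rw [Finset.sum_comm]
        refine Finset.sum_congr rfl fun i _ ↦ ?_
        rw [hXc i, hXq i, Finset.smul_sum, Finset.smul_sum, ← Finset.sum_add_distrib]

end RegDist

end AlongCurves

/-! ### Velocity components in charts and frames. -/

section VelocityInCharts

namespace RegDist

variable {E : Type*} [NormedAddCommGroup E] [NormedSpace ℝ E]
  {M : Type*} [TopologicalSpace M] [ChartedSpace E M] [IsManifold 𝓘(ℝ, E) ∞ M]

/-- The trivialization of the tangent bundle at `p` is, on each fibre over the chart domain, the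
derivative of the chart at `p`. -/
lemma hasDerivAt_extChartAt_comp {γ : ℝ → M} {t : ℝ} (hγ : MDiffAt γ t) {p : M}
    (hp : γ t ∈ (chartAt E p).source) :
    HasDerivAt (fun s ↦ extChartAt 𝓘(ℝ, E) p (γ s))
      (trivializationAt E (fun x : M ↦ TangentSpace 𝓘(ℝ, E) x) p ⟨γ t, velocity γ t⟩).2 t := by
  have hφ : MDiffAt (extChartAt 𝓘(ℝ, E) p) (γ t) := mdifferentiableAt_extChartAt hp
  have h := hφ.comp t hγ
  have h1 := mfderiv_comp_apply t hφ hγ (1 : ℝ)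
  have h2 : mfderiv 𝓘(ℝ, ℝ) 𝓘(ℝ, E) (extChartAt 𝓘(ℝ, E) p ∘ γ) t (1 : ℝ)
      = deriv (extChartAt 𝓘(ℝ, E) p ∘ γ) t := by
    rw [← fderiv_apply_one_eq_deriv, ← mfderiv_eq_fderiv]
    rfl
  have h3 (w : TangentSpace 𝓘(ℝ, E) (γ t)) :
      mfderiv 𝓘(ℝ, E) 𝓘(ℝ, E) (extChartAt 𝓘(ℝ, E) p) (γ t) w
        = (trivializationAt E (fun x : M ↦ TangentSpace 𝓘(ℝ, E) x) p ⟨γ t, w⟩).2 := by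
    rw [← TangentBundle.continuousLinearMapAt_trivializationAt hp]
    have := congrFun (Trivialization.coe_linearMapAt_of_mem (R := ℝ)
      (trivializationAt E (fun x : M ↦ TangentSpace 𝓘(ℝ, E) x) p) hp) w
    exact this
  have h4 := h.differentiableAt.hasDerivAt
  rw [← h2, h1, h3] at h4
  exact h4

variable [FiniteDimensional ℝ E] {ι : Type*} [Fintype ι] {u : Set M} {X : ι → Field E M}

/-- The components of the velocity of a smooth curve in a smooth local frame are differentiable. -/
lemma differentiableAt_coeff_velocity (hs : IsLocalFrameOn 𝓘(ℝ, E) E ∞ X u) (hu : IsOpen u)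
    {J : Set ℝ} (hJ : IsOpen J) {γ : ℝ → M} (hγ : CMDiff[J] ∞ γ) {t : ℝ} (ht : t ∈ J)
    (htu : γ t ∈ u) (i : ι) :
    DifferentiableAt ℝ (fun s ↦ hs.coeff i (γ s) (velocity γ s)) t := by
  let e := trivializationAt E (fun x : M ↦ TangentSpace 𝓘(ℝ, E) x) (γ t)
  have hpe : γ t ∈ e.baseSet := FiberBundle.mem_baseSet_trivializationAt' _
  let b := Module.finBasis ℝ E
  let x : ℝ → E := fun s ↦ extChartAt 𝓘(ℝ, E) (γ t) (γ s)
  have hγd {s : ℝ} (hs : s ∈ J) : MDiffAt γ s :=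
    (hγ.contMDiffAt (hJ.mem_nhds hs)).mdifferentiableAt (by simp)
  obtain ⟨J', hJ'J, hJ', htJ'⟩ : ∃ J' ⊆ J ∩ γ ⁻¹' (u ∩ e.baseSet), IsOpen J' ∧ t ∈ J' :=
    mem_nhds_iff.1 (Filter.inter_mem (hJ.mem_nhds ht) ((hγd ht).continuousAt.preimage_mem_nhds
      ((hu.inter e.open_baseSet).mem_nhds ⟨htu, hpe⟩)))
  have hx : ContDiffOn ℝ ∞ x J' := by
    rw [← contMDiffOn_iff_contDiffOn]
    exact (contMDiffOn_extChartAt (x := γ t)).comp (hγ.mono fun s hs ↦ (hJ'J hs).1)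
      fun s hs ↦ (hJ'J hs).2.2
  have hxd : DifferentiableAt ℝ (deriv x) t :=
    ((hx.deriv_of_isOpen (m := ∞) hJ' (by simp)).contDiffAt
      (hJ'.mem_nhds htJ')).differentiableAt (by simp)
  have hopen := hu.inter e.open_baseSet
  have hfr (k) : CMDiff[u ∩ e.baseSet] ∞ (T% (e.localFrame b k)) :=
    (e.contMDiffOn_localFrame_baseSet ∞ b k).mono Set.inter_subset_right
  have hcd (k) : DifferentiableAt ℝ (fun s ↦ hs.coeff i (γ s) (e.localFrame b k (γ s))) t := by
    have h1 := (hs.mono Set.inter_subset_left).contMDiffOn_coeff hopen (hfr k) i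
    have h2 := (h1.contMDiffAt (hopen.mem_nhds ⟨htu, hpe⟩)).mdifferentiableAt (by simp)
    refine (hasDerivAt_comp_curve h2 (hγd ht)).differentiableAt.congr_of_eventuallyEq ?_
    filter_upwards [hJ'.mem_nhds htJ'] with s hs'
    have hs'' := hJ'J hs'
    rw [hs.coeff_mono Set.inter_subset_left hs''.2]
  -- The velocity has chart components `deriv x`, and `hcd` controls the passage from the chart
  -- frame to `X`.
  have hsum : DifferentiableAt ℝ (fun s ↦ ∑ k, b.repr (deriv x s) k *
      hs.coeff i (γ s) (e.localFrame b k (γ s))) t := by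
    refine DifferentiableAt.fun_sum fun k _ ↦ DifferentiableAt.mul ?_ (hcd k)
    exact ((LinearMap.toContinuousLinearMap (b.coord k)).differentiableAt).comp t hxd
  refine hsum.congr_of_eventuallyEq ?_
  filter_upwards [hJ'.mem_nhds htJ'] with s hs'
  have hs'' := hJ'J hs'
  have hder : deriv x s = (e ⟨γ s, velocity γ s⟩).2 :=
    (hasDerivAt_extChartAt_comp (hγd hs''.1) hs''.2.2).deriv
  have hvel : velocity γ s = ∑ k, b.repr (deriv x s) k • e.localFrame b k (γ s) := by
    rw [hder, ← CovariantDerivative.symm_const_eq b (γ t) hs''.2.2]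
    exact (e.symm_apply_apply_mk hs''.2.2 _).symm
  conv_lhs => rw [hvel]
  simp [map_sum]

end RegDist

end VelocityInCharts

/-! ### Uniqueness for homogeneous linear differential equations. -/

section LinearODE

/-- Vanishing of a solution of a linear differential equation is an open and closed condition. -/
lemma eventually_eq_zero_iff_of_linear_ode {κ : Type*} [Fintype κ] {B : ℝ → κ → κ → ℝ}
    {b : ℝ → κ → ℝ} {t₀ : ℝ} (hB : ∀ k l, ContinuousAt (fun t ↦ B t k l) t₀)
    (hb : ∀ᶠ t in 𝓝 t₀, ∀ k, HasDerivAt (fun s ↦ b s k) (∑ l, B t k l * b t l) t) :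
    ∀ᶠ t in 𝓝 t₀, (b t₀ = 0 ↔ b t = 0) := by
  obtain ⟨K, hK⟩ : ∃ K : NNReal, ∀ᶠ t in 𝓝 t₀, ∀ k l, |B t k l| ≤ K := by
    have h (k l : κ) : ∃ K : NNReal, ∀ᶠ t in 𝓝 t₀, |B t k l| ≤ K := by
      refine ⟨‖B t₀ k l‖₊ + 1, ?_⟩
      filter_upwards [(hB k l).norm.eventually (gt_mem_nhds (lt_add_one _))] with t ht
      simpa using ht.le
    choose K hK using h
    refine ⟨∑ k, ∑ l, K k l, ?_⟩
    simp only [Filter.eventually_all]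
    intro k l
    filter_upwards [hK k l] with t ht
    refine ht.trans (NNReal.coe_le_coe.2 ?_)
    exact (Finset.single_le_sum (f := K k) (fun _ _ ↦ zero_le) (Finset.mem_univ l)).trans
      (Finset.single_le_sum (f := fun k ↦ ∑ l, K k l) (fun _ _ ↦ zero_le) (Finset.mem_univ k))
  obtain ⟨ε, hε, h⟩ := Metric.eventually_nhds_iff_ball.1 (hb.and hK)
  rw [Real.ball_eq_Ioo] at h
  let v : ℝ → (κ → ℝ) → κ → ℝ := fun t x k ↦ ∑ l, B t k l * x l
  -- In the sup norm each row contributes `card κ` entries of size at most `K`.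
  have hv : ∀ t ∈ Set.Ioo (t₀ - ε) (t₀ + ε),
      LipschitzOnWith (Fintype.card κ * K) (v t) Set.univ := fun t ht ↦ by
    refine LipschitzOnWith.of_dist_le_mul fun x _ y _ ↦ ?_
    refine (dist_pi_le_iff (by positivity)).2 fun k ↦ ?_
    rw [Real.dist_eq, ← Finset.sum_sub_distrib]
    refine (Finset.abs_sum_le_sum_abs _ _).trans ?_
    have : ∀ l ∈ Finset.univ, |B t k l * x l - B t k l * y l| ≤ K * dist x y := fun l _ ↦ by
      rw [← mul_sub, abs_mul]
      exact mul_le_mul ((h t ht).2 k l) (dist_le_pi_dist x y l) (abs_nonneg _) K.2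
    refine (Finset.sum_le_sum this).trans ?_
    simp [mul_assoc]
  have hz : ∀ t ∈ Set.Ioo (t₀ - ε) (t₀ + ε),
      HasDerivAt (fun _ ↦ (0 : κ → ℝ)) (v t 0) t ∧ (0 : κ → ℝ) ∈ Set.univ := fun t _ ↦ by
    have : v t 0 = 0 := by ext; simp [v]
    rw [this]
    exact ⟨hasDerivAt_const _ _, trivial⟩
  have hbv : ∀ t ∈ Set.Ioo (t₀ - ε) (t₀ + ε),
      HasDerivAt b (v t (b t)) t ∧ b t ∈ Set.univ := fun t ht ↦
    ⟨hasDerivAt_pi.2 (h t ht).1, trivial⟩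
  have ht₀ : t₀ ∈ Set.Ioo (t₀ - ε) (t₀ + ε) := ⟨by linarith, by linarith⟩
  filter_upwards [Ioo_mem_nhds ht₀.1 ht₀.2] with t ht
  -- Comparison with the zero solution, with initial time `t₀` for one direction and `t` for the
  -- other.
  exact ⟨fun h0 ↦ ODE_solution_unique_of_mem_Ioo hv ht₀ hbv hz h0 ht,
    fun h0 ↦ ODE_solution_unique_of_mem_Ioo hv ht hbv hz h0 ht₀⟩

end LinearODE

/-! ### Adapted frames and extension of local sections. -/

section Distributions

namespace RegDist

section Frames

variable {E : Type*} [NormedAddCommGroup E] [NormedSpace ℝ E] [FiniteDimensional ℝ E]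
  {M : Type*} [TopologicalSpace M] [ChartedSpace E M] [IsManifold 𝓘(ℝ, E) ∞ M]
  {n : ℕ} (D : RegularDistribution E M n)

/-- Near every point a regular distribution is spanned by part of a smooth local frame. -/
lemma RegularDistribution.exists_adaptedFrame (p : M) :
    ∃ (u : Set M) (m : ℕ) (X : Fin n ⊕ Fin m → Field E M), IsOpen u ∧ p ∈ u ∧
      IsLocalFrameOn 𝓘(ℝ, E) E ∞ X u ∧
      ∀ q ∈ u, Submodule.span ℝ (Set.range fun i ↦ X (Sum.inl i) q) = D.fiber q := by
  obtain ⟨U, hU, X₀, hX₀, hspan⟩ := D.exists_localFrame p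
  let e := trivializationAt E (fun x : M ↦ TangentSpace 𝓘(ℝ, E) x) p
  have hpe : p ∈ e.baseSet := FiberBundle.mem_baseSet_trivializationAt' p
  let ξ : Fin n → E := fun i ↦ e.linearEquivAt ℝ p hpe (X₀ i p)
  have hξ : LinearIndependent ℝ ξ :=
    (hspan p (mem_of_mem_nhds hU)).1.map' (e.linearEquivAt ℝ p hpe).toLinearMap
      (LinearEquiv.ker _)
  obtain ⟨W, hW⟩ := (Submodule.span ℝ (Set.range ξ)).exists_isCompl
  let m := Module.finrank ℝ W
  let y : Fin m → E := fun k ↦ (Module.finBasis ℝ W k : E)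
  have hcard : Fintype.card (Fin n ⊕ Fin m) = Module.finrank ℝ E := by
    rw [Fintype.card_sum, ← Submodule.finrank_add_eq_of_isCompl hW, finrank_span_eq_card hξ]
    simp [m]
  have hy : LinearIndependent ℝ y :=
    (Module.finBasis ℝ W).linearIndependent.map' W.subtype W.ker_subtype
  have hξy : LinearIndependent ℝ (Sum.elim ξ y) := by
    refine hξ.sum_type hy (hW.disjoint.mono_right (Submodule.span_le.2 ?_))
    rintro _ ⟨k, rfl⟩
    exact (Module.finBasis ℝ W k).2
  -- The transverse fields have constant components in the trivialization, taken from a basis of a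
  -- complement of `D` at `p`.
  let X : Fin n ⊕ Fin m → Field E M := Sum.elim X₀ fun k q ↦ e.symm q (y k)
  let u₀ := interior U ∩ e.baseSet
  have hu₀ : IsOpen u₀ := isOpen_interior.inter e.open_baseSet
  have hX (j) : CMDiff[u₀] ∞ (T% (X j)) := by
    rcases j with i | k
    · exact (hX₀ i).mono fun q hq ↦ interior_subset hq.1
    · refine ContMDiffOn.mono (t := u₀) (s := e.baseSet) ?_ Set.inter_subset_right
      change CMDiff[e.baseSet] ∞ (T% (fun q ↦ e.symm q (y k)))
      rw [e.contMDiffOn_section_baseSet_iff]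
      refine (contMDiffOn_const (c := y k)).congr fun q hq ↦ ?_
      simp [e.apply_mk_symm hq]
  -- Read in the fixed space `E`, the fields form a continuous family, so independence at `p`
  -- persists nearby.
  let η : M → Fin n ⊕ Fin m → E := fun q j ↦ (e ⟨q, X j q⟩).2
  have hη : ContinuousOn η u₀ := continuousOn_pi.2 fun j ↦
    ((e.contMDiffOn_section_iff hu₀ Set.inter_subset_right).1 (hX j)).continuousOn
  have hηp : LinearIndependent ℝ (η p) := by
    convert hξy using 1
    ext j
    rcases j with i | k
    · rfl
    · simp [η, X, e.apply_mk_symm hpe]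
  refine ⟨u₀ ∩ η ⁻¹' {v | LinearIndependent ℝ v}, m, X,
    hη.isOpen_inter_preimage hu₀ isOpen_setOfPred_linearIndependent,
    ⟨⟨mem_interior_iff_mem_nhds.2 hU, hpe⟩, hηp⟩, ?_, fun q hq ↦
      (hspan q (interior_subset hq.1.1)).2⟩
  have hli {q : M} (hq : q ∈ u₀ ∩ η ⁻¹' {v | LinearIndependent ℝ v}) :
      LinearIndependent ℝ (fun j ↦ X j q) :=
    LinearIndependent.of_comp (e.linearEquivAt ℝ q hq.1.2).toLinearMap hq.2
  exact
    { linearIndependent := hli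
      generating := fun {q} hq ↦ by
        have : FiniteDimensional ℝ (TangentSpace 𝓘(ℝ, E) q) :=
          inferInstanceAs (FiniteDimensional ℝ E)
        exact ((hli hq).span_eq_top_of_card_eq_finrank' hcard).ge
      contMDiffOn := fun j ↦ (hX j).mono Set.inter_subset_left }

lemma mem_span_inl_iff_coeff_inr {n m : ℕ} {u : Set M} {X : Fin n ⊕ Fin m → Field E M}
    (hs : IsLocalFrameOn 𝓘(ℝ, E) E ∞ X u) {q : M} (hq : q ∈ u) (w : TangentSpace 𝓘(ℝ, E) q) :
    w ∈ Submodule.span ℝ (Set.range fun i ↦ X (Sum.inl i) q)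
      ↔ ∀ k, hs.coeff (Sum.inr k) q w = 0 := by
  have h : (Set.range fun i ↦ X (Sum.inl i) q) = hs.toBasisAt hq '' Set.range Sum.inl := by
    rw [← Set.range_comp]
    simp [Function.comp_def]
  rw [h, Module.Basis.mem_span_image]
  simp only [IsLocalFrameOn.coeff, dif_pos hq, Module.Basis.coord_apply]
  constructor
  · intro hw k
    by_contra hk
    simpa using hw (Finsupp.mem_support_iff.2 hk)
  · intro hw j hj
    rcases j with i | k
    · exact ⟨i, rfl⟩
    · exact absurd (hw k) (Finsupp.mem_support_iff.1 hj)

/-- A smooth local section of a distribution agrees near each point with a global one. -/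
lemma RegularDistribution.exists_section_eventuallyEq [T2Space M] {u : Set M} (hu : IsOpen u)
    {X : Field E M} (hX : CMDiff[u] ∞ (T% X)) (hXD : ∀ q ∈ u, X q ∈ D.fiber q) {q : M}
    (hq : q ∈ u) : ∃ Y ∈ D.sections, ∀ᶠ y in 𝓝 q, Y y = X y := by
  obtain ⟨f, -, hf⟩ := (SmoothBumpFunction.nhds_basis_tsupport (I := 𝓘(ℝ, E)) q).mem_iff.1
    (hu.mem_nhds hq)
  refine ⟨(f : M → ℝ) • X, ⟨?_, fun y ↦ ?_⟩, ?_⟩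
  · exact f.contMDiff.contMDiffOn.smul_section_of_tsupport hu hf hX
  · by_cases hy : y ∈ u
    · exact Submodule.smul_mem _ _ (hXD y hy)
    · have : f y = 0 := image_eq_zero_of_notMem_tsupport fun h ↦ hy (hf h)
      simp [this]
  · filter_upwards [f.eventuallyEq_one] with y hy
    simp [hy]

end Frames

end RegDist

end Distributions

/-! ### Closure under the symmetric product implies totally geodesic. -/

section SymmetricProduct

namespace RegDist

variable {E : Type*} [NormedAddCommGroup E] [NormedSpace ℝ E] [FiniteDimensional ℝ E]
  {M : Type*} [TopologicalSpace M] [ChartedSpace E M] [IsManifold 𝓘(ℝ, E) ∞ M]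
  [RiemannianBundle (fun x : M ↦ TangentSpace 𝓘(ℝ, E) x)]
  [IsContMDiffRiemannianBundle 𝓘(ℝ, E) ∞ E (fun x : M ↦ TangentSpace 𝓘(ℝ, E) x)]

/-- `∇_X Y` is pointwise in `X` but only local in `Y`, hence the asymmetric hypotheses. -/
lemma nabla_congr {X X' Y Y' : Field E M} {q : M} (hY : MDiffAt (T% Y) q)
    (hY' : MDiffAt (T% Y') q) (hXX' : X q = X' q) (hYY' : ∀ᶠ y in 𝓝 q, Y y = Y' y) :
    nabla X Y q = nabla X' Y' q := by
  unfold nabla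
  rw [hXX', (leviCivita E M).congr_of_eventuallyEq hY hY' hYY']

section FrameComponents

variable {ι : Type*} [Fintype ι] {u : Set M} {X : ι → Field E M}
  (hs : IsLocalFrameOn 𝓘(ℝ, E) E ∞ X u) {γ : ℝ → M} {t : ℝ}

lemma sum_coeff_smul {q : M} (hq : q ∈ u) (w : TangentSpace 𝓘(ℝ, E) q) :
    w = ∑ i, hs.coeff i q w • X i q := by
  simpa [IsLocalFrameOn.coeff, hq] using ((hs.toBasisAt hq).sum_repr w).symm

/-- The components of `∑ i, (c i • X i + a i • ∇_w (X i))` in the frame `X`. -/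
lemma coeff_sum_smul_add_smul_leviCivita {q : M} (hq : q ∈ u) (a c : ι → ℝ)
    (w : TangentSpace 𝓘(ℝ, E) q) (k : ι) :
    hs.coeff k q (∑ i, (c i • X i q + a i • leviCivita E M (X i) q w))
      = c k + ∑ i, ∑ j, a i * hs.coeff j q w * hs.coeff k q (nabla (X j) (X i) q) := by
  classical
  have hself (i) : hs.coeff k q (X i q) = Finsupp.single i (1 : ℝ) k := by
    rw [hs.coeff_apply_of_mem hq, ← hs.toBasisAt_coe hq, Module.Basis.repr_self]
  have hcov (i) : leviCivita E M (X i) q w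
      = ∑ j, hs.coeff j q w • nabla (X j) (X i) q := by
    conv_lhs => rw [sum_coeff_smul hs hq w]
    simp [map_sum, nabla]
  simp only [map_sum, map_add, map_smul, hself, hcov, Finset.smul_sum,
    Finset.sum_add_distrib, smul_eq_mul, Finsupp.single_apply, mul_ite, mul_one, mul_zero,
    Finset.sum_ite_eq', Finset.mem_univ, if_true, ← mul_assoc]

/-- The components of the acceleration of a curve in a smooth local frame. -/
lemma coeff_covariantDerivAlong_velocity (hu : IsOpen u) (hγ : MDiffAt γ t) (htu : γ t ∈ u)
    {a' : ι → ℝ} (ha : ∀ i, HasDerivAt (fun s ↦ hs.coeff i (γ s) (velocity γ s)) (a' i) t) (k : ι) :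
    hs.coeff k (γ t) (covariantDerivAlong (leviCivita E M) γ (velocity γ) t)
      = a' k + ∑ i, ∑ j, hs.coeff i (γ t) (velocity γ t) * hs.coeff j (γ t) (velocity γ t)
        * hs.coeff k (γ t) (nabla (X j) (X i) (γ t)) := by
  rw [covariantDerivAlong_eq_sum (leviCivita E M) hγ
    (fun i ↦ mdifferentiableAt_section_of_contMDiffOn hu (hs.contMDiffOn i) htu) ha
    (V := velocity γ) (by
      filter_upwards [hγ.continuousAt.preimage_mem_nhds (hu.mem_nhds htu)] with s hsu
      exact sum_coeff_smul hs hsu _), coeff_sum_smul_add_smul_leviCivita hs htu]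

/-- The geodesic equation in a smooth local frame. -/
lemma IsGeodesicOn.hasDerivAt_coeff (hu : IsOpen u) {J : Set ℝ} (hJ : IsOpen J)
    (hγ : IsGeodesicOn E γ J) (ht : t ∈ J) (htu : γ t ∈ u) (k : ι) :
    HasDerivAt (fun s ↦ hs.coeff k (γ s) (velocity γ s))
      (-∑ i, ∑ j, hs.coeff i (γ t) (velocity γ t) * hs.coeff j (γ t) (velocity γ t)
        * hs.coeff k (γ t) (nabla (X j) (X i) (γ t))) t := by
  have hγd : MDiffAt γ t := (hγ.1.contMDiffAt (hJ.mem_nhds ht)).mdifferentiableAt (by simp)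
  have hd (i) := (differentiableAt_coeff_velocity hs hu hJ hγ.1 ht htu i).hasDerivAt
  have h := coeff_covariantDerivAlong_velocity hs hu hγd htu hd k
  rw [hγ.2 t ht, map_zero] at h
  exact (hd k).congr_deriv (neg_eq_of_add_eq_zero_left h.symm).symm

/-- The components of `∇_Y Y` in a smooth local frame. -/
lemma coeff_nabla_self (hu : IsOpen u) {Y : Field E M} (hY : CMDiff[u] ∞ (T% Y)) {q : M}
    (hq : q ∈ u) (k : ι) :
    hs.coeff k q (nabla Y Y q) = d% (fun x ↦ hs.coeff k x (Y x)) q (Y q)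
      + ∑ i, ∑ j, hs.coeff i q (Y q) * hs.coeff j q (Y q)
        * hs.coeff k q (nabla (X j) (X i) q) := by
  have h := (leviCivita E M).sum_smul (s := Finset.univ) (x := q)
    (f := fun i x ↦ hs.coeff i x (Y x)) (X := X)
    (fun i ↦ ((hs.contMDiffOn_coeff hu hY i).contMDiffAt (hu.mem_nhds hq)).mdifferentiableAt
      (by simp))
    (fun i ↦ mdifferentiableAt_section_of_contMDiffOn hu (hs.contMDiffOn i) hq) (Y q)
  rw [← coeff_sum_smul_add_smul_leviCivita hs hq (fun i ↦ hs.coeff i q (Y q))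
    (fun i ↦ d% (fun x ↦ hs.coeff i x (Y x)) q (Y q)) (Y q) k]
  refine congrArg (hs.coeff k q) ?_
  calc nabla Y Y q = leviCivita E M (fun x ↦ ∑ i, hs.coeff i x (Y x) • X i x) q (Y q) := by
        rw [← (leviCivita E M).congr_of_eventuallyEq
          (mdifferentiableAt_section_of_contMDiffOn hu hY hq) h.1
          (hs.eventually_eq_sum_coeff_smul Y (hu.mem_nhds hq))]
        rfl
    _ = _ := h.2
    _ = _ := Finset.sum_congr rfl fun i _ ↦ add_comm _ _

end FrameComponents

variable {n : ℕ} (D : RegularDistribution E M n)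

/-- If `Γ(D)` is closed under the symmetric product, so are the local sections of `D`. -/
lemma nabla_add_nabla_mem_fiber [T2Space M]
    (hD : ∀ X ∈ D.sections, ∀ Y ∈ D.sections, nabla X Y + nabla Y X ∈ D.sections)
    {u : Set M} (hu : IsOpen u) {X Y : Field E M} (hX : CMDiff[u] ∞ (T% X))
    (hY : CMDiff[u] ∞ (T% Y)) (hXD : ∀ q ∈ u, X q ∈ D.fiber q) (hYD : ∀ q ∈ u, Y q ∈ D.fiber q)
    {q : M} (hq : q ∈ u) : nabla X Y q + nabla Y X q ∈ D.fiber q := by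
  obtain ⟨X', hX', hXX'⟩ := D.exists_section_eventuallyEq hu hX hXD hq
  obtain ⟨Y', hY', hYY'⟩ := D.exists_section_eventuallyEq hu hY hYD hq
  have h := (hD X' hX' Y' hY').2 q
  have hXd := mdifferentiableAt_section_of_contMDiffOn hu hX hq
  have hYd := mdifferentiableAt_section_of_contMDiffOn hu hY hq
  rwa [Pi.add_apply,
    nabla_congr (hY'.1.mdifferentiable (by simp) q) hYd hXX'.self_of_nhds hYY',
    nabla_congr (hX'.1.mdifferentiable (by simp) q) hXd hYY'.self_of_nhds hXX'] at h

/-- Antisymmetry kills the block with both indices in `D`; every other term contains some `a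
(Sum.inr l)`, which is factored out. This makes the geodesic equation linear in the transverse
components. -/
lemma sum_mul_mul_eq_of_add_swap_eq_zero {m : ℕ} (a : Fin n ⊕ Fin m → ℝ)
    (C : Fin n ⊕ Fin m → Fin n ⊕ Fin m → ℝ)
    (hC : ∀ i j, C (Sum.inl i) (Sum.inl j) + C (Sum.inl j) (Sum.inl i) = 0) :
    -∑ i, ∑ j, a i * a j * C i j = ∑ l : Fin m, -(∑ i : Fin n, a (Sum.inl i) *
      C (Sum.inl i) (Sum.inr l) + ∑ j, a j * C (Sum.inr l) j) * a (Sum.inr l) := by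
  have h0 : ∑ i : Fin n, ∑ j : Fin n,
      a (Sum.inl i) * a (Sum.inl j) * C (Sum.inl i) (Sum.inl j) = 0 := by
    have h : ∑ i : Fin n, ∑ j : Fin n, a (Sum.inl i) * a (Sum.inl j) * C (Sum.inl i) (Sum.inl j)
        = -∑ i : Fin n, ∑ j : Fin n,
          a (Sum.inl i) * a (Sum.inl j) * C (Sum.inl i) (Sum.inl j) := by
      conv_lhs => rw [Finset.sum_comm]
      simp only [← Finset.sum_neg_distrib]
      refine Finset.sum_congr rfl fun i _ ↦ Finset.sum_congr rfl fun j _ ↦ ?_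
      linear_combination a (Sum.inl i) * a (Sum.inl j) * hC i j
    linarith
  have h1 : ∑ i : Fin n, ∑ l : Fin m, a (Sum.inl i) * a (Sum.inr l) * C (Sum.inl i) (Sum.inr l)
      = ∑ l : Fin m, (∑ i : Fin n, a (Sum.inl i) * C (Sum.inl i) (Sum.inr l)) * a (Sum.inr l) := by
    rw [Finset.sum_comm]
    refine Finset.sum_congr rfl fun l _ ↦ ?_
    rw [Finset.sum_mul]
    exact Finset.sum_congr rfl fun i _ ↦ by ring
  have h2 : ∑ l : Fin m, ∑ j, a (Sum.inr l) * a j * C (Sum.inr l) j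
      = ∑ l : Fin m, (∑ j, a j * C (Sum.inr l) j) * a (Sum.inr l) := by
    refine Finset.sum_congr rfl fun l _ ↦ ?_
    rw [Finset.sum_mul]
    exact Finset.sum_congr rfl fun i _ ↦ by ring
  rw [Fintype.sum_sum_type, h2]
  simp only [Fintype.sum_sum_type (fun j ↦ a (Sum.inl _) * a j * C (Sum.inl _) j)]
  rw [Finset.sum_add_distrib, h0, h1, zero_add, ← Finset.sum_add_distrib,
    ← Finset.sum_neg_distrib]
  exact Finset.sum_congr rfl fun l _ ↦ by ring

/-- If `Γ(D)` is closed under the symmetric product, tangency to `D` propagates along geodesics. -/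
lemma eventually_velocity_mem_iff [T2Space M]
    (hD : ∀ X ∈ D.sections, ∀ Y ∈ D.sections, nabla X Y + nabla Y X ∈ D.sections)
    {J : Set ℝ} (hJ : IsOpen J) {γ : ℝ → M} (hγ : IsGeodesicOn E γ J) {t₀ : ℝ} (ht₀ : t₀ ∈ J) :
    ∀ᶠ t in 𝓝 t₀, (velocity γ t₀ ∈ D.fiber (γ t₀) ↔ velocity γ t ∈ D.fiber (γ t)) := by
  obtain ⟨u, m, X, hu, hpu, hs, hspan⟩ := D.exists_adaptedFrame (γ t₀)
  have hγd {t : ℝ} (ht : t ∈ J) : MDiffAt γ t :=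
    (hγ.1.contMDiffAt (hJ.mem_nhds ht)).mdifferentiableAt (by simp)
  have hev : ∀ᶠ t in 𝓝 t₀, t ∈ J ∧ γ t ∈ u := Filter.Eventually.and (hJ.mem_nhds ht₀)
    ((hγd ht₀).continuousAt.preimage_mem_nhds (hu.mem_nhds hpu))
  have hmem (q) (hq : q ∈ u) (w : TangentSpace 𝓘(ℝ, E) q) :
      w ∈ D.fiber q ↔ ∀ k, hs.coeff (Sum.inr k) q w = 0 := by
    rw [← hspan q hq]
    exact mem_span_inl_iff_coeff_inr hs hq w
  have hXD (i : Fin n) (q) (hq : q ∈ u) : X (Sum.inl i) q ∈ D.fiber q := by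
    rw [← hspan q hq]
    exact Submodule.subset_span ⟨i, rfl⟩
  let a (t : ℝ) (i : Fin n ⊕ Fin m) : ℝ := hs.coeff i (γ t) (velocity γ t)
  let C (k : Fin m) (i j : Fin n ⊕ Fin m) (q : M) : ℝ :=
    hs.coeff (Sum.inr k) q (nabla (X j) (X i) q)
  have hac (i) : ContinuousAt (fun t ↦ a t i) t₀ :=
    (differentiableAt_coeff_velocity hs hu hJ hγ.1 ht₀ hpu i).continuousAt
  have hCc (k i j) : ContinuousAt (fun t ↦ C k i j (γ t)) t₀ := by
    have h := hs.contMDiffOn_coeff hu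
      (contMDiffOn_nabla hu (hs.contMDiffOn j) (hs.contMDiffOn i)) (Sum.inr k)
    exact ContinuousAt.comp (f := γ) (h.contMDiffAt (hu.mem_nhds hpu)).continuousAt
      (hγd ht₀).continuousAt
  have hCsymm (k) (i j : Fin n) (q) (hq : q ∈ u) :
      C k (Sum.inl i) (Sum.inl j) q + C k (Sum.inl j) (Sum.inl i) q = 0 := by
    rw [← map_add]
    exact (hmem q hq _).1 (nabla_add_nabla_mem_fiber D hD hu (hs.contMDiffOn _)
      (hs.contMDiffOn _) (hXD j) (hXD i) hq) k
  -- The coefficients `B` involve the velocity itself, but along the given geodesic they are known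
  -- continuous functions of time.
  have hode := eventually_eq_zero_iff_of_linear_ode (κ := Fin m)
    (b := fun t k ↦ a t (Sum.inr k))
    (B := fun t k l ↦ -(∑ i : Fin n, a t (Sum.inl i) * C k (Sum.inl i) (Sum.inr l) (γ t)
      + ∑ j, a t j * C k (Sum.inr l) j (γ t))) (t₀ := t₀) (fun k l ↦ ?_) ?_
  · filter_upwards [hode, hev] with t h1 h2
    rw [hmem _ hpu, hmem _ h2.2]
    rw [funext_iff, funext_iff] at h1
    exact h1
  · refine ((tendsto_finsetSum _ fun i _ ↦ ?_).add (tendsto_finsetSum _ fun j _ ↦ ?_)).neg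
    · exact (hac _).mul (hCc _ _ _)
    · exact (hac _).mul (hCc _ _ _)
  · filter_upwards [hev] with t ht k
    rw [← sum_mul_mul_eq_of_add_swap_eq_zero (a t) (fun i j ↦ C k i j (γ t))
      (fun i j ↦ hCsymm k i j _ ht.2)]
    exact IsGeodesicOn.hasDerivAt_coeff hs hu hJ hγ ht.1 ht.2 (Sum.inr k)

theorem RegularDistribution.isTotallyGeodesic_of_symmetricProduct [T2Space M]
    (hD : ∀ X ∈ D.sections, ∀ Y ∈ D.sections, nabla X Y + nabla Y X ∈ D.sections) :
    D.IsTotallyGeodesic := by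
  intro J γ hJ hJc hγ t₀ ht₀ h0 t ht
  -- Tangency at nearby times is equivalent, and implications compose, so it spreads over the
  -- connected set `J`.
  refine hJc.isPreconnected.induction₂'
    (fun s s' ↦ velocity γ s ∈ D.fiber (γ s) → velocity γ s' ∈ D.fiber (γ s'))
    (fun s hs ↦ ?_) (fun x y z _ _ _ h1 h2 h ↦ h2 (h1 h)) ht₀ ht h0
  filter_upwards [nhdsWithin_le_nhds (eventually_velocity_mem_iff D hD hJ hγ hs)] with s' h
  exact ⟨h.1, h.2⟩

end RegDist

end SymmetricProduct

/-! ### Existence of geodesics, and the converse implication. -/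

section Geodesics

namespace RegDist

variable {E : Type*} [NormedAddCommGroup E] [NormedSpace ℝ E] [FiniteDimensional ℝ E]
  {M : Type*} [TopologicalSpace M] [ChartedSpace E M] [IsManifold 𝓘(ℝ, E) ∞ M]
  [RiemannianBundle (fun x : M ↦ TangentSpace 𝓘(ℝ, E) x)]
  [IsContMDiffRiemannianBundle 𝓘(ℝ, E) ∞ E (fun x : M ↦ TangentSpace 𝓘(ℝ, E) x)]

/-- Smooth autonomous differential equations have smooth local solutions. -/
lemma exists_contDiffOn_hasDerivAt {F : Type*} [NormedAddCommGroup F] [NormedSpace ℝ F]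
    [CompleteSpace F] {f : F → F} {Ω : Set F} (hΩ : IsOpen Ω) (hf : ContDiffOn ℝ ∞ f Ω) {x₀ : F}
    (hx₀ : x₀ ∈ Ω) :
    ∃ (α : ℝ → F) (ε : ℝ), 0 < ε ∧ α 0 = x₀ ∧ ContDiffOn ℝ ∞ α (Set.Ioo (-ε) ε) ∧
      ∀ t ∈ Set.Ioo (-ε) ε, α t ∈ Ω ∧ HasDerivAt α (f (α t)) t := by
  obtain ⟨α, h0, ε, hε, hα⟩ :=
    ((hf.contDiffAt (hΩ.mem_nhds hx₀)).of_le
      (by simp)).exists_forall_mem_closedBall_exists_eq_forall_mem_Ioo_hasDerivAt₀ 0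
  have hcont : ContinuousAt α 0 := (hα 0 (by simp [hε])).continuousAt
  obtain ⟨δ, hδ, hδΩ⟩ := Metric.eventually_nhds_iff_ball.1
    (hcont.eventually (hΩ.mem_nhds (h0.symm ▸ hx₀)))
  rw [Real.ball_eq_Ioo] at hδΩ
  have hm : 0 < min ε δ := lt_min hε hδ
  have hsub {t : ℝ} (ht : t ∈ Set.Icc (-(min ε δ / 2)) (min ε δ / 2)) :
      t ∈ Set.Ioo (0 - ε) (0 + ε) ∧ t ∈ Set.Ioo (0 - δ) (0 + δ) := by
    have h1 := min_le_left ε δ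
    have h2 := min_le_right ε δ
    exact ⟨⟨by linarith [ht.1], by linarith [ht.2]⟩, ⟨by linarith [ht.1], by linarith [ht.2]⟩⟩
  -- Halving keeps the closed interval, on which the regularity theorem is applied, inside both open
  -- intervals.
  refine ⟨α, min ε δ / 2, by positivity, h0, ?_, fun t ht ↦ ?_⟩
  · refine ContDiffOn.mono (s := Set.Icc (-(min ε δ / 2)) (min ε δ / 2)) ?_ Set.Ioo_subset_Icc_self
    refine ODE.contDiffOn_enat_Icc_of_hasDerivWithinAt (n := ⊤) (f := fun _ ↦ f) (u := Ω)
      (hf.comp contDiffOn_snd fun x hx ↦ hx.2)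
      (fun t ht ↦ (hα t (hsub ht).1).hasDerivWithinAt) fun t ht ↦ hδΩ t (hsub ht).2
  · have ht' := hsub (Set.Ioo_subset_Icc_self ht)
    exact ⟨hδΩ t ht'.2, hα t ht'.1⟩

/-- Through every point there is a geodesic with prescribed velocity. -/
lemma exists_isGeodesicOn (X : Field E M) (p : M) :
    ∃ (γ : ℝ → M) (ε : ℝ), 0 < ε ∧ IsGeodesicOn E γ (Set.Ioo (-ε) ε) ∧ γ 0 = p ∧
      velocity γ 0 = X (γ 0) := by
  let e := trivializationAt E (fun x : M ↦ TangentSpace 𝓘(ℝ, E) x) p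
  have hpe : p ∈ e.baseSet := FiberBundle.mem_baseSet_trivializationAt' p
  let φ := extChartAt 𝓘(ℝ, E) p
  have hbase : e.baseSet = φ.source := (extChartAt_source 𝓘(ℝ, E) p).symm
  have hΩ : IsOpen φ.target := isOpen_extChartAt_target p
  let b := Module.finBasis ℝ E
  have hs := e.isLocalFrameOn_localFrame_baseSet 𝓘(ℝ, E) ∞ b
  have hco {q : M} (hq : q ∈ e.baseSet) (w : TangentSpace 𝓘(ℝ, E) q) (k) :
      hs.coeff k q w = b.repr (e ⟨q, w⟩).2 k := by
    have h : e.localFrameCoeff 𝓘(ℝ, E) b k q w = b.repr (e ⟨q, w⟩).2 k := by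
      simpa using e.localFrameCoeff_eq_coeff (I := 𝓘(ℝ, E)) (b := b) (i := k)
        (s := FiberBundle.extend E w) hq
    exact h
  let C (k i j) (q : M) : ℝ := hs.coeff k q (nabla (e.localFrame b j) (e.localFrame b i) q)
  have hC (k i j) : CMDiff[e.baseSet] ∞ (C k i j) :=
    hs.contMDiffOn_coeff e.open_baseSet
      (contMDiffOn_nabla e.open_baseSet (hs.contMDiffOn j) (hs.contMDiffOn i)) k
  have hCφ (k i j) : ContDiffOn ℝ ∞ (fun x ↦ C k i j (φ.symm x)) φ.target := by
    rw [← contMDiffOn_iff_contDiffOn]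
    refine (hC k i j).comp (contMDiffOn_extChartAt_symm p) fun x hx ↦ ?_
    rw [hbase]
    exact φ.map_target hx
  -- The geodesic spray in the chart: the second-order equation as a first-order system in position
  -- and velocity.
  let f (z : E × E) : E × E :=
    (z.2, ∑ k, (-∑ i, ∑ j, b.repr z.2 i * b.repr z.2 j * C k i j (φ.symm z.1)) • b k)
  have hrepr (i) : ContDiff ℝ ∞ (fun z : E × E ↦ b.repr z.2 i) :=
    (LinearMap.toContinuousLinearMap (b.coord i)).contDiff.comp contDiff_snd
  have hf : ContDiffOn ℝ ∞ f (φ.target ×ˢ Set.univ) := by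
    refine contDiff_snd.contDiffOn.prodMk (ContDiffOn.sum fun k _ ↦ ContDiffOn.smul
      (ContDiffOn.neg (ContDiffOn.sum fun i _ ↦ ContDiffOn.sum fun j _ ↦ ?_)) contDiffOn_const)
    exact ((hrepr i).contDiffOn.mul (hrepr j).contDiffOn).mul
      ((hCφ k i j).comp contDiffOn_fst fun z hz ↦ hz.1)
  obtain ⟨α, ε, hε, h0, hα, hαd⟩ := exists_contDiffOn_hasDerivAt (hΩ.prod isOpen_univ) hf
    (x₀ := (φ p, (e ⟨p, X p⟩).2)) ⟨mem_extChartAt_target p, trivial⟩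
  let γ : ℝ → M := fun t ↦ φ.symm (α t).1
  have hγs {t : ℝ} (ht : t ∈ Set.Ioo (-ε) ε) : γ t ∈ e.baseSet := by
    rw [hbase]
    exact φ.map_target (hαd t ht).1.1
  have hγ : CMDiff[Set.Ioo (-ε) ε] ∞ γ := by
    refine (contMDiffOn_extChartAt_symm p).comp (contMDiffOn_iff_contDiffOn.2
      (contDiff_fst.comp_contDiffOn hα)) fun t ht ↦ (hαd t ht).1.1
  have hγd {t : ℝ} (ht : t ∈ Set.Ioo (-ε) ε) : MDiffAt γ t :=
    (hγ.contMDiffAt (isOpen_Ioo.mem_nhds ht)).mdifferentiableAt (by simp)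
  -- The first equation of the system identifies the second component of `α` with the velocity of
  -- `γ`.
  have hvel {t : ℝ} (ht : t ∈ Set.Ioo (-ε) ε) : (e ⟨γ t, velocity γ t⟩).2 = (α t).2 := by
    refine (hasDerivAt_extChartAt_comp (hγd ht) (p := p) (hγs ht)).unique ?_
    have h1 : HasDerivAt (fun s ↦ (α s).1) (α t).2 t := (hαd t ht).2.fst
    refine h1.congr_of_eventuallyEq ?_
    filter_upwards [isOpen_Ioo.mem_nhds ht] with s hs'
    exact φ.right_inv (hαd s hs').1.1
  have h0mem : (0 : ℝ) ∈ Set.Ioo (-ε) ε := ⟨by linarith, hε⟩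
  have hγ0 : γ 0 = p := by
    change φ.symm (α 0).1 = p
    rw [h0]
    exact φ.left_inv (mem_extChartAt_source p)
  refine ⟨γ, ε, hε, ⟨hγ, fun t ht ↦ ?_⟩, hγ0, ?_⟩
  · have hcoeff (k) : HasDerivAt (fun s ↦ hs.coeff k (γ s) (velocity γ s))
        (-∑ i, ∑ j, hs.coeff i (γ t) (velocity γ t) * hs.coeff j (γ t) (velocity γ t)
          * C k i j (γ t)) t := by
      have h1 : HasDerivAt (fun s ↦ (α s).2) (f (α t)).2 t := (hαd t ht).2.snd
      have h2 := (LinearMap.toContinuousLinearMap (b.coord k)).hasFDerivAt.comp_hasDerivAt t h1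
      have h3 : (LinearMap.toContinuousLinearMap (b.coord k)) (f (α t)).2
          = -∑ i, ∑ j, hs.coeff i (γ t) (velocity γ t) * hs.coeff j (γ t) (velocity γ t)
          * C k i j (γ t) := by
        simp only [hco (hγs ht), hvel ht]
        change b.repr (f (α t)).2 k = _
        rw [b.repr_sum_self]
      rw [h3] at h2
      refine h2.congr_of_eventuallyEq ?_
      filter_upwards [isOpen_Ioo.mem_nhds ht] with s hs'
      rw [hco (hγs hs'), hvel hs']
      rfl
    rw [sum_coeff_smul hs (hγs ht) (covariantDerivAlong (leviCivita E M) γ (velocity γ) t)]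
    refine Finset.sum_eq_zero fun k _ ↦ ?_
    rw [coeff_covariantDerivAlong_velocity hs e.open_baseSet (hγd ht) (hγs ht) hcoeff]
    simp [C]
  · have h1 : (e ⟨γ 0, velocity γ 0⟩).2 = (e ⟨γ 0, X (γ 0)⟩).2 := by
      rw [hvel h0mem, h0, hγ0]
    exact (e.linearEquivAt ℝ (γ 0) (hγs h0mem)).injective h1

variable {n : ℕ} {D : RegularDistribution E M n}

lemma RegularDistribution.IsTotallyGeodesic.nabla_self_mem_fiber (hD : D.IsTotallyGeodesic)
    {X : Field E M} (hX : X ∈ D.sections) (p : M) : nabla X X p ∈ D.fiber p := by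
  obtain ⟨γ, ε, hε, hγ, rfl, hγX⟩ := exists_isGeodesicOn X p
  obtain ⟨u, m, Y, hu, hpu, hs, hspan⟩ := D.exists_adaptedFrame (γ 0)
  have h0mem : (0 : ℝ) ∈ Set.Ioo (-ε) ε := ⟨by linarith, hε⟩
  have hmem (q) (hq : q ∈ u) (w : TangentSpace 𝓘(ℝ, E) q) :
      w ∈ D.fiber q ↔ ∀ k, hs.coeff (Sum.inr k) q w = 0 := by
    rw [← hspan q hq]
    exact mem_span_inl_iff_coeff_inr hs hq w
  have hcont : ContinuousAt γ 0 :=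
    (hγ.1.contMDiffAt (isOpen_Ioo.mem_nhds h0mem)).continuousAt
  have hvel : ∀ t ∈ Set.Ioo (-ε) ε, velocity γ t ∈ D.fiber (γ t) :=
    hD _ γ isOpen_Ioo Set.ordConnected_Ioo hγ 0 h0mem (hγX ▸ hX.2 (γ 0))
  rw [hmem _ hpu]
  intro k
  rw [coeff_nabla_self hs hu hX.1.contMDiffOn hpu]
  have h1 : d% (fun x ↦ hs.coeff (Sum.inr k) x (X x)) (γ 0) = 0 := by
    have hev : (fun x ↦ hs.coeff (Sum.inr k) x (X x)) =ᶠ[𝓝 (γ 0)] fun _ ↦ (0 : ℝ) := by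
      filter_upwards [hu.mem_nhds hpu] with q hq
      exact (hmem q hq _).1 (hX.2 q) k
    have hd := hev.mfderiv_eq (I := 𝓘(ℝ, E)) (I' := 𝓘(ℝ, ℝ))
    unfold mvfderiv
    rw [hd, mfderiv_const]
    rfl
  have h2 : HasDerivAt (fun s ↦ hs.coeff (Sum.inr k) (γ s) (velocity γ s)) 0 0 := by
    refine (hasDerivAt_const (0 : ℝ) (0 : ℝ)).congr_of_eventuallyEq ?_
    filter_upwards [isOpen_Ioo.mem_nhds h0mem, hcont.preimage_mem_nhds (hu.mem_nhds hpu)]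
      with s h h'
    exact (hmem _ h' _).1 (hvel s h) k
  -- The transverse velocity component is constantly zero near time `0`, so the quadratic term of
  -- the geodesic equation vanishes there; since the velocity is `X (γ 0)`, it is the one left in
  -- `∇_X X`.
  have h3 := (IsGeodesicOn.hasDerivAt_coeff hs hu isOpen_Ioo hγ h0mem hpu (Sum.inr k)).unique h2
  rw [hγX, neg_eq_zero] at h3
  rw [h1, h3]
  simp

theorem RegularDistribution.IsTotallyGeodesic.symmetricProduct_mem (hD : D.IsTotallyGeodesic)
    {X Y : Field E M} (hX : X ∈ D.sections) (hY : Y ∈ D.sections) :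
    nabla X Y + nabla Y X ∈ D.sections := by
  have hsmooth {X Y : Field E M} (hX : X ∈ D.sections) (hY : Y ∈ D.sections) :
      CMDiff ∞ (T% (nabla X Y)) :=
    contMDiffOn_univ.1 (contMDiffOn_nabla isOpen_univ hX.1.contMDiffOn hY.1.contMDiffOn)
  refine ⟨(hsmooth hX hY).add_section (hsmooth hY hX), fun p ↦ ?_⟩
  have hXY : X + Y ∈ D.sections :=
    ⟨hX.1.add_section hY.1, fun q ↦ Submodule.add_mem _ (hX.2 q) (hY.2 q)⟩
  -- Polarization of the quadratic map `X ↦ ∇_X X`.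
  have hadd : nabla (X + Y) (X + Y) p
      = nabla X X p + nabla Y Y p + (nabla X Y + nabla Y X) p := by
    have h := (leviCivita E M).isCovariantDerivativeOnUniv.add
      (hX.1.mdifferentiable (by simp) p) (hY.1.mdifferentiable (by simp) p)
    simp only [nabla, Pi.add_apply]
    rw [h]
    simp only [map_add, add_apply]
    abel
  have h := Submodule.sub_mem _ (hD.nabla_self_mem_fiber hXY p)
    (Submodule.add_mem _ (hD.nabla_self_mem_fiber hX p) (hD.nabla_self_mem_fiber hY p))
  rwa [hadd, add_sub_cancel_left] at h

end RegDist

end Geodesics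

theorem mainTheorem6
    {E : Type*} [NormedAddCommGroup E] [NormedSpace ℝ E] [FiniteDimensional ℝ E]
    {M : Type*} [TopologicalSpace M] [T2Space M] [ChartedSpace E M] [IsManifold 𝓘(ℝ, E) ∞ M]
    [RiemannianBundle (fun x : M ↦ TangentSpace 𝓘(ℝ, E) x)]
    [IsContMDiffRiemannianBundle 𝓘(ℝ, E) ∞ E (fun x : M ↦ TangentSpace 𝓘(ℝ, E) x)]
    {n : ℕ} (D : RegDist.RegularDistribution E M n) :
    D.IsTotallyGeodesic ↔
      ∀ X ∈ D.sections, ∀ Y ∈ D.sections, RegDist.nabla X Y + RegDist.nabla Y X ∈ D.sections :=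
  ⟨fun hD _ hX _ hY ↦ hD.symmetricProduct_mem hX hY,
    fun hD ↦ D.isTotallyGeodesic_of_symmetricProduct hD⟩
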